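/- Graphs are finite, undirected, without loops and multiple edges (not necessarily connected). Let $\mathrm{FO}^2_\#$ be the logic of formulas built from two variables $x_0,x_1$ (which may be requantified), with atomic formulas for equality and adjacency of vertices, Boolean connectives, and the quantifiers $\exists^m x_i\,\varphi$ ($m\in\mathbb{N}$), meaning "there are at least $m$ vertices $x_i$ with $\varphi$" (so $\exists=\exists^1$ and $\forall=\neg\exists^1\neg$). Each quantifier $\exists^m$ contributes $1$ to the quantifier depth, irrespectively of $m$. A sentence (formula without free variables) distinguishes $G$ and $H$ if it is true on exactly one of them; $G$ and $H$ are distinguishable in $\mathrm{FO}^2_\#$ if some sentence of $\mathrm{FO}^2_\#$ distinguishes them, and then $D(G,H)$ denotes the minimum quantifier depth of such a sentence. (1) If $G$ and $H$ are graphs with $n$ vertices each that are distinguishable in $\mathrm{FO}^2_\#$, then $D(G,H)\le n+1$. (2) For each $n\ge 2$ there are $n$-vertex graphs $G$ and $H$ that are distinguishable in $\mathrm{FO}^2_\#$ and satisfy $D(G,H)>n-8\sqrt n$. -/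

import Mathlib

/-- Formulas of two-variable first-order logic with counting quantifiers over graphs. The two
variables are the elements of `Fin 2`, and the same variable may be quantified repeatedly.
`exGE m i φ` is `∃^m xᵢ φ`: there are at least `m` vertices `xᵢ` with `φ`. The other connectives
are Boolean combinations of `neg` and `conj`; `∃ xᵢ φ` is `exGE 1 i φ`, and `∀ xᵢ φ` is
`neg (exGE 1 i (neg φ))`, both with the quantifier depth of the usual quantifiers. -/
inductive FO2C : Type
  | eq (i j : Fin 2) : FO2C
  | adj (i j : Fin 2) : FO2C
  | neg (φ : FO2C) : FO2C
  | conj (φ ψ : FO2C) : FO2C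
  | exGE (m : ℕ) (i : Fin 2) (φ : FO2C) : FO2C

namespace FO2C

/-- The free variables of a formula. -/
def freeVars : FO2C → Finset (Fin 2)
  | eq i j => {i, j}
  | adj i j => {i, j}
  | neg φ => φ.freeVars
  | conj φ ψ => φ.freeVars ∪ ψ.freeVars
  | exGE _ i φ => φ.freeVars.erase i

/-- The quantifier depth; a counting quantifier contributes 1 irrespectively of `m`. -/
def depth : FO2C → ℕ
  | eq _ _ => 0
  | adj _ _ => 0
  | neg φ => φ.depth
  | conj φ ψ => max φ.depth ψ.depth
  | exGE _ _ φ => φ.depth + 1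

/-- Truth of a formula in the graph `G` under a partial assignment `σ` of vertices to the two
variables (`none` means that the variable has no value, so that sentences can be evaluated
also in a graph without vertices). Only the values at free variables matter, see `sat_congr`. -/
def Sat {V : Type*} (G : SimpleGraph V) : FO2C → (Fin 2 → Option V) → Prop
  | eq i j, σ => ∃ a, σ i = some a ∧ σ j = some a
  | adj i j, σ => ∃ a b, σ i = some a ∧ σ j = some b ∧ G.Adj a b
  | neg φ, σ => ¬ Sat G φ σ
  | conj φ ψ, σ => Sat G φ σ ∧ Sat G ψ σ
  | exGE m i φ, σ => (m : ℕ∞) ≤ {a : V | Sat G φ (Function.update σ i (some a))}.encard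

theorem sat_congr {V : Type*} (G : SimpleGraph V) (φ : FO2C) :
    ∀ σ τ : Fin 2 → Option V, (∀ i ∈ φ.freeVars, σ i = τ i) → (Sat G φ σ ↔ Sat G φ τ) := by
  induction φ with
  | eq i j => intro σ τ h; simp [Sat, h i (by simp [freeVars]), h j (by simp [freeVars])]
  | adj i j => intro σ τ h; simp [Sat, h i (by simp [freeVars]), h j (by simp [freeVars])]
  | neg φ ih => intro σ τ h; exact not_congr (ih σ τ h)
  | conj φ ψ ih₁ ih₂ =>
    intro σ τ h
    exact and_congr (ih₁ σ τ fun i hi => h i (Finset.mem_union_left _ hi))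
      (ih₂ σ τ fun i hi => h i (Finset.mem_union_right _ hi))
  | exGE m i φ ih =>
    intro σ τ h
    have : ∀ a, Sat G φ (Function.update σ i (some a)) ↔
        Sat G φ (Function.update τ i (some a)) := fun a => ih _ _ fun j hj => by
      by_cases hji : j = i
      · subst hji; simp
      · simpa [hji] using h j (Finset.mem_erase.2 ⟨hji, hj⟩)
    simp only [Sat, this]

/-- A sentence is a formula without free variables. -/
def IsSentence (φ : FO2C) : Prop := φ.freeVars = ∅

/-- Truth of a sentence in a graph: no variable has a value at the beginning. -/
def Holds {V : Type*} (φ : FO2C) (G : SimpleGraph V) : Prop := Sat G φ (fun _ => none)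

/-- The sentence `φ` is true on exactly one of the graphs `G` and `H`. -/
def Distinguishes {V W : Type*} (φ : FO2C) (G : SimpleGraph V) (H : SimpleGraph W) : Prop :=
  φ.IsSentence ∧ Xor (φ.Holds G) (φ.Holds H)

end FO2C

/-- `G` and `H` are distinguishable in two-variable counting logic. -/
def FO2CDistinguishable {V W : Type*} (G : SimpleGraph V) (H : SimpleGraph W) : Prop :=
  ∃ φ : FO2C, φ.Distinguishes G H

/-- `D(G,H)`: the minimum quantifier depth of a sentence that distinguishes `G` and `H`. It is
used only for distinguishable graphs, where the set is non-empty and the infimum is attained. -/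
noncomputable def FO2CDepth {V W : Type*} (G : SimpleGraph V) (H : SimpleGraph W) : ℕ :=
  sInf {d : ℕ | ∃ φ : FO2C, φ.Distinguishes G H ∧ φ.depth = d}

/-! Both bounds rest on the correspondence between `FO2C`, colour refinement and the bijective
two-pebble game: depth measures rounds of refinement.

Upper bound. Colour refinement runs on the disjoint sum of `G` and `H`, so that both graphs share
one palette. The classes of round `k` are definable at depth `k` (`definable_colourRefinement`), and
counting such a class costs one more quantifier. Suppose no sentence of depth at most `n + 1`
distinguishes the graphs. Then up to round `n` every class has equally many vertices on both sides,
hence meets `V`, so there are at most `n` classes. Each unstable round adds a class, starting from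
one, so the refinement is stable by round `n` (`exists_stable_or_lt_card_quotient`). A stable
balanced colouring lets the game be survived forever, and no sentence distinguishes the graphs
(`holds_iff_of_depth_le_card`).

Lower bound. The ladder graphs force refinement to cross a path of about `n / 4` pairs for about `n`
rounds in total, two rounds per pair before and two after the turning points combined. Ranks spread
from both ends to the middle; there the crossed pairs `l + 1`, `l + 3` break the mirror symmetry;
this news returns to the ends and separates the two triggers; the left trigger then tells apart the
two vertices of the first pair, and this choice of a bit travels the whole path to the last pair.
Only when the bits at both ends can be compared does the comparison gadget reveal which of its two
matchings is present. `LadderVertex.survives` gives the survival of `4 * l + 8` rounds on at most `4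
* l + 22` vertices, and `LadderVertex.exists_distinguishes` follows the same route to a
distinguishing sentence. The resulting loss is a constant, below `8 √n` once `n ≥ 19`; smaller `n`
are trivial. -/

/-! ### Bijections that preserve colours -/

theorem exists_equiv_of_card_fiber_eq {V W K : Type*} [Finite V] [Finite W] (f : V → K) (g : W → K)
    (h : ∀ k, {a | f a = k}.ncard = {b | g b = k}.ncard) : ∃ e : V ≃ W, ∀ a, g (e a) = f a := by
  have h' : ∀ k, Nonempty ({a // f a = k} ≃ {b // g b = k}) := fun k =>
    Finite.card_eq.1 (by have := h k; rwa [← Nat.card_coe_set_eq, ← Nat.card_coe_set_eq] at this)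
  let e := fun k => (h' k).some
  exact ⟨Equiv.ofFiberEquiv e, fun a => Equiv.ofFiberEquiv_map e a⟩

open Classical in
theorem ncard_fiber_eq_add {U K : Type*} [Finite U] (F : SimpleGraph U) (c : U → K) (u : U) (k : K) :
    {a | c a = k}.ncard = {a | F.Adj u a ∧ c a = k}.ncard + (if c u = k then 1 else 0) +
      {a | c a = k ∧ ¬ F.Adj u a ∧ a ≠ u}.ncard := by
  have h1 : {a | c a = k} = ({a | F.Adj u a ∧ c a = k} ∪ {a | a = u ∧ c a = k}) ∪
      {a | c a = k ∧ ¬ F.Adj u a ∧ a ≠ u} := by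
    ext a; simp only [Set.mem_union, Set.mem_ofPred_eq]; tauto
  have h2 : {a | a = u ∧ c a = k}.ncard = if c u = k then 1 else 0 := by
    split_ifs with hc
    · rw [show {a | a = u ∧ c a = k} = {u} by ext a; simp; rintro rfl; exact hc]; simp
    · rw [show {a | a = u ∧ c a = k} = ∅ by ext a; simp; rintro rfl; exact hc]; simp
  rw [h1, Set.ncard_union_eq _ (Set.toFinite _) (Set.toFinite _),
    Set.ncard_union_eq _ (Set.toFinite _) (Set.toFinite _), h2]
  · rw [Set.disjoint_left]; rintro a ⟨ha, -⟩ ⟨rfl, -⟩; exact F.irrefl ha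
  · rw [Set.disjoint_left]; rintro a ha ⟨h3, h4, h5⟩
    rcases ha with ⟨ha, -⟩ | ⟨ha, -⟩
    exacts [h4 ha, h5 ha]

/-- Two vertices with equally many neighbours of each colour correspond to each other under a
colour-preserving bijection that preserves adjacency to them. -/
theorem exists_equiv_pointed {V W K : Type*} [Finite V] [Finite W] (G : SimpleGraph V)
    (H : SimpleGraph W) (f : V → K) (g : W → K) (x : V) (y : W) (hxy : f x = g y)
    (h : ∀ k, {a | f a = k}.ncard = {b | g b = k}.ncard)
    (hN : ∀ k, {a | G.Adj x a ∧ f a = k}.ncard = {b | H.Adj y b ∧ g b = k}.ncard) :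
    ∃ e : V ≃ W, e x = y ∧ (∀ a, G.Adj x a ↔ H.Adj y (e a)) ∧ ∀ a, f a = g (e a) := by
  classical
  -- Adjacency to the base point and equality with it are added to the colour; it then suffices to
  -- compare fibres.
  obtain ⟨e, he⟩ := exists_equiv_of_card_fiber_eq (fun a => (f a, G.Adj x a, a = x))
    (fun b => (g b, H.Adj y b, b = y)) (by
      rintro ⟨k, P, Q⟩
      simp only [Prod.mk.injEq]
      by_cases hP : P <;> by_cases hQ : Q <;> simp only [hP, hQ, eq_iff_iff, iff_true, iff_false]
      · rw [show {a | f a = k ∧ G.Adj x a ∧ a = x} = ∅ by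
            ext a; simp; rintro - h rfl; exact G.irrefl h,
          show {a | g a = k ∧ H.Adj y a ∧ a = y} = ∅ by
            ext a; simp; rintro - h rfl; exact H.irrefl h]
        simp
      · rw [show {a | f a = k ∧ G.Adj x a ∧ ¬ a = x} = {a | G.Adj x a ∧ f a = k} by
            ext a; simp only [Set.mem_ofPred_eq]
            exact ⟨fun h => ⟨h.2.1, h.1⟩, fun h => ⟨h.2, h.1, fun hh => G.irrefl (hh ▸ h.1)⟩⟩,
          show {a | g a = k ∧ H.Adj y a ∧ ¬ a = y} = {a | H.Adj y a ∧ g a = k} by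
            ext a; simp only [Set.mem_ofPred_eq]
            exact ⟨fun h => ⟨h.2.1, h.1⟩, fun h => ⟨h.2, h.1, fun hh => H.irrefl (hh ▸ h.1)⟩⟩]
        exact hN k
      · by_cases hk : f x = k
        · rw [show {a | f a = k ∧ ¬ G.Adj x a ∧ a = x} = {x} by
              ext a; simp only [Set.mem_ofPred_eq, Set.mem_singleton_iff]
              exact ⟨fun h => h.2.2, by rintro rfl; exact ⟨hk, G.irrefl, rfl⟩⟩,
            show {a | g a = k ∧ ¬ H.Adj y a ∧ a = y} = {y} by
              ext a; simp only [Set.mem_ofPred_eq, Set.mem_singleton_iff]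
              exact ⟨fun h => h.2.2, by rintro rfl; exact ⟨hxy ▸ hk, H.irrefl, rfl⟩⟩]
          simp
        · rw [show {a | f a = k ∧ ¬ G.Adj x a ∧ a = x} = ∅ by
              ext a; simp; rintro h - rfl; exact hk h,
            show {a | g a = k ∧ ¬ H.Adj y a ∧ a = y} = ∅ by
              ext a; simp; rintro h - rfl; exact hk (hxy.trans h)]
          simp
      -- The non-neighbours are what remains of a colour class after the neighbours and the base
      -- point are removed.
      · have h1 := ncard_fiber_eq_add G f x k
        have h2 := ncard_fiber_eq_add H g y k
        rw [← hxy] at h2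
        have := hN k; have := h k
        simp only [ne_eq] at h1 h2
        omega)
  refine ⟨e, ?_, fun a => ?_, fun a => ?_⟩
  · have := he x; simp only [Prod.mk.injEq] at this; simpa using this.2.2
  · have := he a; simp only [Prod.mk.injEq] at this; exact (iff_of_eq this.2.1).symm
  · have := he a; simp only [Prod.mk.injEq] at this; exact this.1.symm

/-! ### The bijective game bounds quantifier depth from below -/

/-- `Survives G H N R`: from a pair of vertices in the relation `R`, the bijective two-pebble game
on `G` and `H` can be survived for `N` rounds. -/
inductive Survives {V W : Type*} (G : SimpleGraph V) (H : SimpleGraph W) :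
    ℕ → (V → W → Prop) → Prop
  | zero (R : V → W → Prop) : Survives G H 0 R
  | succ (N : ℕ) (R R' : V → W → Prop) (survives : Survives G H N R')
      (start : ∃ e : V ≃ W, ∀ a, R' a (e a))
      (forth : ∀ x y, R x y → ∃ e : V ≃ W, e x = y ∧ (∀ a, G.Adj x a ↔ H.Adj y (e a)) ∧
        ∀ a, R' a (e a)) : Survives G H (N + 1) R

namespace FO2C

/-- Partial assignments with the same domain and the same atomic type, and with related values. -/
structure Matching {V W : Type*} (G : SimpleGraph V) (H : SimpleGraph W) (R : V → W → Prop)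
    (σ : Fin 2 → Option V) (τ : Fin 2 → Option W) : Prop where
  none_iff : ∀ i, σ i = none ↔ τ i = none
  rel : ∀ i a b, σ i = some a → τ i = some b → R a b
  eq_iff : ∀ i j a b a' b', σ i = some a → σ j = some b → τ i = some a' → τ j = some b' →
    (a = b ↔ a' = b')
  adj_iff : ∀ i j a b a' b', σ i = some a → σ j = some b → τ i = some a' → τ j = some b' →
    (G.Adj a b ↔ H.Adj a' b')

theorem exists_some_of_none_iff {V W : Type*} {o : Option V} {p : Option W}
    (h : o = none ↔ p = none) {a : V} (ha : o = some a) : ∃ b, p = some b := by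
  cases p with
  | none => simp [h.2 rfl] at ha
  | some b => exact ⟨b, rfl⟩

/-- With two variables, only the value of `j` is kept when `i` is reassigned. A bijection that
respects adjacency to that single vertex therefore preserves every atomic formula. -/
theorem Matching.update {V W : Type*} {G : SimpleGraph V} {H : SimpleGraph W}
    {R' : V → W → Prop} {σ : Fin 2 → Option V} {τ : Fin 2 → Option W} (i j : Fin 2) (hij : j ≠ i)
    (h0 : σ j = none ↔ τ j = none) (e : V ≃ W) (he : ∀ a, R' a (e a))
    (hj : ∀ x y, σ j = some x → τ j = some y → e x = y ∧ ∀ a, G.Adj x a ↔ H.Adj y (e a)) (a : V) :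
    Matching G H R' (Function.update σ i (some a)) (Function.update τ i (some (e a))) := by
  have key : ∀ k b b', Function.update σ i (some a) k = some b →
      Function.update τ i (some (e a)) k = some b' → e b = b' ∧ (k = i ∧ b = a ∨ k = j ∧
        ∀ a, G.Adj b a ↔ H.Adj b' (e a)) := by
    intro k b b' h1 h2
    by_cases hk : k = i
    · subst hk; simp at h1 h2; subst h1; subst h2; exact ⟨rfl, Or.inl ⟨rfl, rfl⟩⟩
    · have hk' : k = j := by omega
      subst hk'
      rw [Function.update_of_ne hk] at h1 h2
      exact ⟨(hj _ _ h1 h2).1, Or.inr ⟨rfl, (hj _ _ h1 h2).2⟩⟩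
  refine ⟨fun k => ?_, fun k b b' h1 h2 => ?_, fun k l b c b' c' h1 h2 h3 h4 => ?_,
    fun k l b c b' c' h1 h2 h3 h4 => ?_⟩
  · by_cases hk : k = i
    · subst hk; simp
    · have hk' : k = j := by omega
      subst hk'
      rwa [Function.update_of_ne hk, Function.update_of_ne hk]
  · rw [← (key k b b' h1 h2).1]; exact he b
  · rw [← (key k b b' h1 h3).1, ← (key l c c' h2 h4).1]; simp
  · obtain ⟨hb, hb'⟩ := key k b b' h1 h3
    obtain ⟨hc, hc'⟩ := key l c c' h2 h4
    rcases hb' with ⟨-, rfl⟩ | ⟨-, hb'⟩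
    · rcases hc' with ⟨-, rfl⟩ | ⟨-, hc'⟩
      · subst hb; subst hc; simp
      · rw [G.adj_comm, H.adj_comm, hc', hb]
    · rw [hb', hc]

/-- The bijection of one round maps the witnesses of a counting quantifier in `G` onto those in `H`,
so all thresholds `m` are treated alike and one quantifier costs one round. If the other variable
has no value, the bijection comes from `start`, otherwise from `forth`. -/
theorem sat_iff_of_survives {V W : Type*} (G : SimpleGraph V) (H : SimpleGraph W) (φ : FO2C) :
    ∀ (N : ℕ) (R : V → W → Prop), Survives G H N R → φ.depth ≤ N → ∀ σ τ, Matching G H R σ τ →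
      (Sat G φ σ ↔ Sat H φ τ) := by
  induction φ with
  | eq i j =>
    intro N R _ _ σ τ h
    constructor
    · rintro ⟨a, h1, h2⟩
      obtain ⟨b, hb⟩ := exists_some_of_none_iff (h.none_iff i) h1
      obtain ⟨c, hc⟩ := exists_some_of_none_iff (h.none_iff j) h2
      exact ⟨b, hb, by rw [hc, (h.eq_iff i j a a b c h1 h2 hb hc).1 rfl]⟩
    · rintro ⟨a, h1, h2⟩
      obtain ⟨b, hb⟩ := exists_some_of_none_iff (h.none_iff i).symm h1
      obtain ⟨c, hc⟩ := exists_some_of_none_iff (h.none_iff j).symm h2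
      exact ⟨b, hb, by rw [hc, (h.eq_iff i j b c a a hb hc h1 h2).2 rfl]⟩
  | adj i j =>
    intro N R _ _ σ τ h
    constructor
    · rintro ⟨a, a', h1, h2, h3⟩
      obtain ⟨b, hb⟩ := exists_some_of_none_iff (h.none_iff i) h1
      obtain ⟨c, hc⟩ := exists_some_of_none_iff (h.none_iff j) h2
      exact ⟨b, c, hb, hc, (h.adj_iff i j _ _ _ _ h1 h2 hb hc).1 h3⟩
    · rintro ⟨a, a', h1, h2, h3⟩
      obtain ⟨b, hb⟩ := exists_some_of_none_iff (h.none_iff i).symm h1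
      obtain ⟨c, hc⟩ := exists_some_of_none_iff (h.none_iff j).symm h2
      exact ⟨b, c, hb, hc, (h.adj_iff i j _ _ _ _ hb hc h1 h2).2 h3⟩
  | neg φ ih => intro N R hS hd σ τ h; exact not_congr (ih N R hS hd σ τ h)
  | conj φ ψ ih₁ ih₂ =>
    intro N R hS hd σ τ h
    exact and_congr (ih₁ N R hS (le_trans (le_max_left _ _) hd) σ τ h)
      (ih₂ N R hS (le_trans (le_max_right _ _) hd) σ τ h)
  | exGE m i φ ih =>
    intro N R hS hd σ τ h
    cases hS with
    | zero => simp [depth] at hd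
    | succ N _ R' hS start forth =>
      obtain ⟨j, hij⟩ : ∃ j : Fin 2, j ≠ i := ⟨i + 1, by omega⟩
      obtain ⟨e, he, hj⟩ : ∃ e : V ≃ W, (∀ a, R' a (e a)) ∧ ∀ x y, σ j = some x →
          τ j = some y → e x = y ∧ ∀ a, G.Adj x a ↔ H.Adj y (e a) := by
        cases hσ : σ j with
        | none =>
          obtain ⟨e, he⟩ := start
          exact ⟨e, he, by simp⟩
        | some x =>
          obtain ⟨y, hy⟩ := exists_some_of_none_iff (h.none_iff j) hσ
          obtain ⟨e, h1, h2, h3⟩ := forth x y (h.rel j x y hσ hy)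
          refine ⟨e, h3, fun x' y' hx' hy' => ?_⟩
          rw [hy] at hy'
          cases hx'; cases hy'
          exact ⟨h1, h2⟩
      have key : ∀ a, Sat G φ (Function.update σ i (some a)) ↔
          Sat H φ (Function.update τ i (some (e a))) := fun a =>
        ih N R' hS (by simpa [depth] using hd) _ _ (.update i j hij (h.none_iff j) e he hj a)
      have himg : {b | Sat H φ (Function.update τ i (some b))} =
          e '' {a | Sat G φ (Function.update σ i (some a))} := by
        ext b
        simp only [Set.mem_ofPred_eq, Set.mem_image, key]
        exact ⟨fun hb => ⟨e.symm b, by simpa using hb, by simp⟩, by rintro ⟨a, ha, rfl⟩; exact ha⟩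
      simp only [Sat, himg, e.injective.encard_image]

theorem holds_iff_of_survives {V W : Type*} {G : SimpleGraph V} {H : SimpleGraph W} {φ : FO2C}
    {N : ℕ} {R : V → W → Prop} (hS : Survives G H N R) (hd : φ.depth ≤ N) :
    φ.Holds G ↔ φ.Holds H :=
  sat_iff_of_survives G H φ N R hS hd _ _ ⟨by simp, by simp, by simp, by simp⟩

theorem survives_of_stable {V W : Type*} {G : SimpleGraph V} {H : SimpleGraph W}
    {R : V → W → Prop} (start : ∃ e : V ≃ W, ∀ a, R a (e a))
    (forth : ∀ x y, R x y → ∃ e : V ≃ W, e x = y ∧ (∀ a, G.Adj x a ↔ H.Adj y (e a)) ∧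
      ∀ a, R a (e a)) (N : ℕ) : Survives G H N R := by
  induction N with
  | zero => exact .zero R
  | succ N ih => exact .succ N R R ih start forth

theorem holds_iff_of_iso {V W : Type*} {G : SimpleGraph V} {H : SimpleGraph W} (e : G ≃g H)
    (φ : FO2C) : φ.Holds G ↔ φ.Holds H :=
  holds_iff_of_survives (survives_of_stable (R := fun a b => e a = b) ⟨e.toEquiv, fun _ => rfl⟩
    (fun x y h => ⟨e.toEquiv, h, fun a => by subst h; exact e.map_adj_iff.symm, fun _ => rfl⟩)
    φ.depth) le_rfl

/-! ### Simultaneously definable sets -/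

/-- The sets `p` of vertices of `G` and `q` of vertices of `H` are defined by one and the same
formula of quantifier depth at most `d`, in either variable. -/
def Definable {V W : Type*} (G : SimpleGraph V) (H : SimpleGraph W) (d : ℕ) (p : V → Prop)
    (q : W → Prop) : Prop :=
  ∀ i : Fin 2, ∃ φ : FO2C, φ.freeVars ⊆ {i} ∧ φ.depth ≤ d ∧
    (∀ σ a, σ i = some a → (Sat G φ σ ↔ p a)) ∧ ∀ σ a, σ i = some a → (Sat H φ σ ↔ q a)

section Definable

variable {V W : Type*} {G : SimpleGraph V} {H : SimpleGraph W} {d : ℕ} {p p' : V → Prop}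
  {q q' : W → Prop}

theorem Definable.mono {d' : ℕ} (h : Definable G H d p q) (hd : d ≤ d') : Definable G H d' p q :=
  fun i => (h i).imp fun _ hφ => ⟨hφ.1, hφ.2.1.trans hd, hφ.2.2⟩

theorem Definable.true (d : ℕ) : Definable G H d (fun _ => True) (fun _ => True) :=
  fun i => ⟨eq i i, by simp [freeVars], by simp [depth], by simp +contextual [Sat],
    by simp +contextual [Sat]⟩

theorem Definable.not (h : Definable G H d p q) :
    Definable G H d (fun a => ¬ p a) (fun b => ¬ q b) := fun i => by
  obtain ⟨φ, h1, h2, h3, h4⟩ := h i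
  exact ⟨neg φ, h1, h2, fun σ a ha => not_congr (h3 σ a ha), fun σ a ha => not_congr (h4 σ a ha)⟩

theorem Definable.and (h : Definable G H d p q) (h' : Definable G H d p' q') :
    Definable G H d (fun a => p a ∧ p' a) (fun b => q b ∧ q' b) := fun i => by
  obtain ⟨φ, h1, h2, h3, h4⟩ := h i
  obtain ⟨ψ, h1', h2', h3', h4'⟩ := h' i
  exact ⟨conj φ ψ, Finset.union_subset h1 h1', max_le h2 h2',
    fun σ a ha => and_congr (h3 σ a ha) (h3' σ a ha),
    fun σ a ha => and_congr (h4 σ a ha) (h4' σ a ha)⟩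

theorem Definable.all {ι : Type*} [Finite ι] {p : ι → V → Prop} {q : ι → W → Prop}
    (h : ∀ z, Definable G H d (p z) (q z)) :
    Definable G H d (fun a => ∀ z, p z a) (fun b => ∀ z, q z b) := by
  classical
  have key : ∀ s : Set ι, s.Finite →
      Definable G H d (fun a => ∀ z ∈ s, p z a) (fun b => ∀ z ∈ s, q z b) := by
    intro s hs
    induction s, hs using Set.Finite.induction_on with
    | empty => simpa using Definable.true d
    | insert _ _ ih => simpa using (h _).and ih
  simpa using key Set.univ Set.finite_univ

theorem Definable.le_neighbours (h : Definable G H d p q) (k : ℕ) :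
    Definable G H (d + 1) (fun a => (k : ℕ∞) ≤ {b | G.Adj a b ∧ p b}.encard)
      (fun a => (k : ℕ∞) ≤ {b | H.Adj a b ∧ q b}.encard) := fun i => by
  obtain ⟨j, hij⟩ : ∃ j : Fin 2, j ≠ i := ⟨i + 1, by omega⟩
  obtain ⟨φ, h1, h2, h3, h4⟩ := h j
  refine ⟨exGE k j (conj (adj i j) φ), ?_, ?_, fun σ a ha => ?_, fun σ a ha => ?_⟩
  · intro l hl
    simp only [freeVars, Finset.mem_erase, Finset.mem_union, Finset.mem_insert,
      Finset.mem_singleton] at hl ⊢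
    omega
  · simpa [depth] using h2
  · simp only [Sat]
    congr! with b
    · simp [hij.symm, ha]
    · exact h3 _ b (by simp)
  · simp only [Sat]
    congr! with b
    · simp [hij.symm, ha]
    · exact h4 _ b (by simp)

theorem Definable.exists_neighbour (h : Definable G H d p q) :
    Definable G H (d + 1) (fun a => ∃ b, G.Adj a b ∧ p b) (fun a => ∃ b, H.Adj a b ∧ q b) := by
  simpa [Set.one_le_encard_iff_nonempty, Set.Nonempty] using h.le_neighbours 1

/-- Unequal cardinalities are separated by some finite threshold `k`, and one quantifier `∃^k`
expresses it. -/
theorem Definable.exists_distinguishes (h : Definable G H d p q)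
    (hne : {a | p a}.encard ≠ {b | q b}.encard) :
    ∃ φ : FO2C, φ.Distinguishes G H ∧ φ.depth ≤ d + 1 := by
  obtain ⟨φ, h1, h2, h3, h4⟩ := h 0
  have hG : ∀ k, (exGE k 0 φ).Holds G ↔ (k : ℕ∞) ≤ {a | p a}.encard := fun k => by
    simp [Holds, Sat, h3 _ _ (Function.update_self _ _ _)]
  have hH : ∀ k, (exGE k 0 φ).Holds H ↔ (k : ℕ∞) ≤ {b | q b}.encard := fun k => by
    simp [Holds, Sat, h4 _ _ (Function.update_self _ _ _)]
  obtain ⟨k, hk⟩ : ∃ k : ℕ, ¬ ((k : ℕ∞) ≤ {a | p a}.encard ↔ (k : ℕ∞) ≤ {b | q b}.encard) := by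
    by_contra! hcon
    exact hne (ENat.eq_of_forall_natCast_le_iff hcon)
  refine ⟨exGE k 0 φ, ⟨?_, ?_⟩, by simpa [depth] using h2⟩
  · simp only [IsSentence, freeVars]
    ext l
    have := @h1 l
    simp only [Finset.mem_singleton] at this
    simp only [Finset.mem_erase, Finset.notMem_empty, iff_false]
    tauto
  · rw [hG, hH, xor_iff_not_iff]; exact hk

end Definable

end FO2C
open FO2C

/-! ### Colour refinement and the upper bound -/

/-- The vertices of `X` have the same colour after `k` rounds of colour refinement. -/
def colourRefinement {X : Type*} (F : SimpleGraph X) : ℕ → Setoid X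
  | 0 => ⊤
  | k + 1 =>
    { r := fun x y => colourRefinement F k x y ∧ ∀ z,
        {a | F.Adj x a ∧ colourRefinement F k a z}.ncard =
          {a | F.Adj y a ∧ colourRefinement F k a z}.ncard
      iseqv := ⟨fun x => ⟨(colourRefinement F k).refl x, fun _ => rfl⟩,
        fun h => ⟨(colourRefinement F k).symm h.1, fun z => (h.2 z).symm⟩,
        fun h h' => ⟨(colourRefinement F k).trans h.1 h'.1, fun z => (h.2 z).trans (h'.2 z)⟩⟩ }

theorem colourRefinement_succ {X : Type*} (F : SimpleGraph X) (k : ℕ) (x y : X) :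
    colourRefinement F (k + 1) x y ↔ colourRefinement F k x y ∧ ∀ z,
        {a | F.Adj x a ∧ colourRefinement F k a z}.ncard =
          {a | F.Adj y a ∧ colourRefinement F k a z}.ncard := Iff.rfl

section Sum

variable {V W : Type*} (G : SimpleGraph V) (H : SimpleGraph W)

theorem ncard_neighbours_inl (x : V) (p : V ⊕ W → Prop) :
    {a | (G ⊕g H).Adj (Sum.inl x) a ∧ p a}.ncard = {a | G.Adj x a ∧ p (Sum.inl a)}.ncard := by
  rw [← Set.ncard_image_of_injective {a | G.Adj x a ∧ p (Sum.inl a)}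
    (Sum.inl_injective (β := W))]
  congr 1
  ext a
  rcases a with a | a <;> simp

theorem ncard_neighbours_inr (x : W) (p : V ⊕ W → Prop) :
    {a | (G ⊕g H).Adj (Sum.inr x) a ∧ p a}.ncard = {a | H.Adj x a ∧ p (Sum.inr a)}.ncard := by
  rw [← Set.ncard_image_of_injective {a | H.Adj x a ∧ p (Sum.inr a)}
    (Sum.inr_injective (α := V))]
  congr 1
  ext a
  rcases a with a | a <;> simp

variable {G H}

theorem le_encard_iff_le_ncard {α : Type*} [Finite α] (s : Set α) (k : ℕ) :
    (k : ℕ∞) ≤ s.encard ↔ k ≤ s.ncard := by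
  rw [← (Set.toFinite s).cast_ncard_eq, Nat.cast_le]

theorem FO2C.Definable.ncard_neighbours_eq [Finite V] [Finite W] {d : ℕ} {p : V → Prop}
    {q : W → Prop} (h : Definable G H d p q) (k : ℕ) :
    Definable G H (d + 1) (fun a => {b | G.Adj a b ∧ p b}.ncard = k)
      (fun a => {b | H.Adj a b ∧ q b}.ncard = k) := by
  convert (h.le_neighbours k).and (h.le_neighbours (k + 1)).not using 3 <;>
  · rw [le_encard_iff_le_ncard, le_encard_iff_le_ncard]; omega

/-- The representative `z` may lie in either graph: its neighbour counts enter the formula only as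
fixed numbers, one for each of the finitely many `z'`. -/
theorem definable_colourRefinement [Finite V] [Finite W] (k : ℕ) : ∀ z : V ⊕ W,
    Definable G H k (fun a => colourRefinement (G ⊕g H) k (Sum.inl a) z)
      (fun b => colourRefinement (G ⊕g H) k (Sum.inr b) z) := by
  induction k with
  | zero => exact fun z => Definable.true 0
  | succ k ih =>
    intro z
    simp only [colourRefinement_succ, ncard_neighbours_inl, ncard_neighbours_inr]
    exact ((ih z).mono (Nat.le_succ k)).and (Definable.all fun z' => (ih z').ncard_neighbours_eq _)

end Sum

/-- Colour refinement is stable after `k` rounds or makes at least `k + 1` classes. -/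
theorem exists_stable_or_lt_card_quotient {X : Type*} [Finite X] [Nonempty X] (F : SimpleGraph X)
    (n : ℕ) : (∃ k < n, ∀ x y, colourRefinement F k x y → colourRefinement F (k + 1) x y) ∨
      n < Nat.card (Quotient (colourRefinement F n)) := by
  induction n with
  | zero =>
    have : Nonempty (Quotient (colourRefinement F 0)) := ⟨Quotient.mk _ (Classical.arbitrary X)⟩
    exact Or.inr Nat.card_pos
  | succ n ih =>
    rcases ih with ⟨k, hk, h⟩ | ih
    · exact Or.inl ⟨k, by omega, h⟩
    by_cases hs : ∀ x y, colourRefinement F n x y → colourRefinement F (n + 1) x y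
    · exact Or.inl ⟨n, by omega, hs⟩
    right
    refine lt_of_le_of_lt ih ?_
    push Not at hs
    obtain ⟨x, y, h1, h2⟩ := hs
    -- The classes of the next round map onto the present ones. Two vertices separated by that round
    -- make this map non-injective, so the number of classes grows.
    let f : Quotient (colourRefinement F (n + 1)) → Quotient (colourRefinement F n) :=
      Quotient.map' id fun a b h => h.1
    have hf : Function.Surjective f := fun a => by
      induction a using Quotient.inductionOn with
      | h a => exact ⟨Quotient.mk _ a, rfl⟩
    refine lt_of_le_of_ne (Nat.card_le_card_of_surjective f hf) fun hcard => ?_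
    have hinj : Function.Injective f :=
      ((Nat.bijective_iff_surjective_and_card f).2 ⟨hf, hcard.symm⟩).1
    exact h2 (Quotient.exact (hinj (Quotient.sound h1 : f (Quotient.mk _ x) = f (Quotient.mk _ y))))

/-- Graphs with `n` vertices that agree on the sentences of depth at most `n + 1` agree on all
sentences. -/
theorem holds_iff_of_depth_le_card {V W : Type*} [Finite V] [Finite W] (G : SimpleGraph V)
    (H : SimpleGraph W) (hn : ¬ ∃ φ : FO2C, φ.Distinguishes G H ∧ φ.depth ≤ Nat.card V + 1)
    (φ : FO2C) : φ.Holds G ↔ φ.Holds H := by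
  set F := G ⊕g H
  -- A class of round `k` has depth `k`, and counting it gives a sentence of depth `k + 1 ≤ Nat.card
  -- V + 1`.
  have hcount : ∀ k ≤ Nat.card V, ∀ z, {a | colourRefinement F k (Sum.inl a) z}.ncard =
      {b | colourRefinement F k (Sum.inr b) z}.ncard := by
    intro k hk z
    by_contra hne
    obtain ⟨φ, h1, h2⟩ := (definable_colourRefinement (G := G) (H := H) k z).exists_distinguishes
      fun h => hne (by simp only [Set.ncard, F, h])
    exact hn ⟨φ, h1, by omega⟩
  obtain ⟨k, hk, hs⟩ : ∃ k ≤ Nat.card V,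
      ∀ x y, colourRefinement F k x y → colourRefinement F (k + 1) x y := by
    rcases isEmpty_or_nonempty (V ⊕ W) with hX | hX
    · exact ⟨0, Nat.zero_le _, fun x => hX.elim x⟩
    rcases exists_stable_or_lt_card_quotient F (Nat.card V) with ⟨k, hk, h⟩ | h
    · exact ⟨k, hk.le, h⟩
    · exfalso
      -- Every class contains a vertex of `V`, because `hcount` balances the two sides; hence there
      -- are at most `Nat.card V` classes.
      refine absurd h (not_lt.2 (Nat.card_le_card_of_surjective (fun a : V =>
        (Quotient.mk (colourRefinement F (Nat.card V)) (Sum.inl a))) fun z => ?_))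
      induction z using Quotient.inductionOn with
      | h z =>
        suffices hne : {a | colourRefinement F (Nat.card V) (Sum.inl a) z}.Nonempty from
          hne.imp fun a ha => Quotient.sound ha
        rcases z with a | b
        · exact ⟨a, (colourRefinement F _).refl _⟩
        · rw [← Set.ncard_pos, hcount _ le_rfl, Set.ncard_pos]
          exact ⟨b, (colourRefinement F _).refl _⟩
  let f : V → Quotient (colourRefinement F k) := fun a => Quotient.mk _ (Sum.inl a)
  let g : W → Quotient (colourRefinement F k) := fun a => Quotient.mk _ (Sum.inr a)
  have hfg : ∀ z, {a | f a = z}.ncard = {b | g b = z}.ncard := fun z => by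
    induction z using Quotient.inductionOn with
    | h z =>
      convert hcount k hk z using 4
      exacts [Quotient.eq, Quotient.eq]
  refine holds_iff_of_survives (survives_of_stable (R := fun a b => f a = g b) ?_ ?_ φ.depth) le_rfl
  · obtain ⟨e, he⟩ := exists_equiv_of_card_fiber_eq f g hfg
    exact ⟨e, fun a => (he a).symm⟩
  · intro x y hxy
    refine exists_equiv_pointed G H f g x y hxy hfg fun z => ?_
    induction z using Quotient.inductionOn with
    | h z =>
      have := (hs _ _ (Quotient.exact hxy)).2 z
      rw [ncard_neighbours_inl, ncard_neighbours_inr] at this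
      convert this using 5
      exacts [Quotient.eq, Quotient.eq]

theorem fo2cDepth_le_card_add_one {V W : Type*} [Finite V] [Finite W] (G : SimpleGraph V)
    (H : SimpleGraph W) (h : FO2CDistinguishable G H) : FO2CDepth G H ≤ Nat.card V + 1 := by
  by_contra hlt
  obtain ⟨φ, -, hφ⟩ := h
  rw [xor_iff_not_iff] at hφ
  refine hφ (holds_iff_of_depth_le_card G H ?_ φ)
  rintro ⟨ψ, h1, h2⟩
  have hle : FO2CDepth G H ≤ ψ.depth := Nat.sInf_le ⟨ψ, h1, rfl⟩
  exact hlt (hle.trans h2)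
-- The ladder graphs
/-- Vertices of the ladder graphs: a path of `2 l + 6` pairs `ch i e`, a comparison gadget `q a b`,
a trigger `t a` with an apex `w`, and `k` isolated vertices. -/
inductive LadderVertex (l k : ℕ) : Type
  | ch (i : ℕ) (hi : i < 2 * l + 6) (e : Bool) : LadderVertex l k
  | q (a b : Bool) : LadderVertex l k
  | t (a : Bool) : LadderVertex l k
  | w : LadderVertex l k
  | iso (i : Fin k) : LadderVertex l k

namespace LadderVertex

variable {l k : ℕ}

/-- The vertex type as a sum of finite types. -/
def equivSum (l k : ℕ) : LadderVertex l k ≃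
    (Fin (2 * l + 6) × Bool) ⊕ (Bool × Bool) ⊕ Bool ⊕ Unit ⊕ Fin k where
  toFun
    | ch i hi e => .inl (⟨i, hi⟩, e)
    | q a b => .inr (.inl (a, b))
    | t a => .inr (.inr (.inl a))
    | w => .inr (.inr (.inr (.inl ())))
    | iso i => .inr (.inr (.inr (.inr i)))
  invFun
    | .inl (i, e) => ch i.1 i.2 e
    | .inr (.inl (a, b)) => q a b
    | .inr (.inr (.inl a)) => t a
    | .inr (.inr (.inr (.inl _))) => w
    | .inr (.inr (.inr (.inr i))) => iso i
  left_inv x := by cases x <;> rfl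
  right_inv x := by rcases x with x | x | x | x | x <;> rfl

instance : Finite (LadderVertex l k) := Finite.of_equiv _ (equivSum l k).symm

theorem natCard (l k : ℕ) : Nat.card (LadderVertex l k) = 4 * l + 19 + k := by
  rw [Nat.card_congr (equivSum l k)]
  simp
  ring

/-- The neighbours of a path vertex on the side of the first pair. -/
def nbLeft (i : ℕ) (hi : i < 2 * l + 6) (e : Bool) : List (LadderVertex l k) :=
  if i = 0 then [q e false, q e true, t false] else [ch (i - 1) (by omega) e]

/-- The neighbours of a path vertex on the side of the last pair. -/
def nbRight (i : ℕ) (hi : i < 2 * l + 6) (e : Bool) : List (LadderVertex l k) :=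
  if h : i = 2 * l + 5 then [q false e, q true e, t true] else [ch (i + 1) (by omega) e]

/-- The extra neighbour of a path vertex: the pairs `l + 1` and `l + 3` are joined to each other,
every other pair is an edge. -/
def nbInner (i : ℕ) (hi : i < 2 * l + 6) (e : Bool) : List (LadderVertex l k) :=
  if i = l + 1 then [ch (l + 3) (by omega) e] else
    if i = l + 3 then [ch (l + 1) (by omega) e] else [ch i hi (!e)]

/-- The neighbours of a vertex. The flag `f` selects one of two perfect matchings on the comparison
gadget. -/
def nb (f : Bool) : LadderVertex l k → List (LadderVertex l k)
  | ch i hi e => nbLeft i hi e ++ (nbRight i hi e ++ nbInner i hi e)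
  | q a b => [ch 0 (by omega) a, ch (2 * l + 5) (by omega) b, t a, q (!a) (xor f b)]
  | t false => [ch 0 (by omega) false, ch 0 (by omega) true, q false false, q false true, w]
  | t true => [ch (2 * l + 5) (by omega) false, ch (2 * l + 5) (by omega) true,
      q true false, q true true, w]
  | w => [t false, t true]
  | iso _ => []

theorem ch_mem_nb_ch (f : Bool) (i j : ℕ) (hi : i < 2 * l + 6) (hj : j < 2 * l + 6) (e e' : Bool) :
    (ch j hj e' : LadderVertex l k) ∈ nb f (ch i hi e) ↔
      (e' = e ∧ (j + 1 = i ∨ i + 1 = j ∨ (i = l + 1 ∧ j = l + 3) ∨ (i = l + 3 ∧ j = l + 1))) ∨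
        (e' = !e) ∧ i = j ∧ i ≠ l + 1 ∧ i ≠ l + 3 := by
  have h1 : (ch j hj e' : LadderVertex l k) ∈ nbLeft i hi e ↔ e' = e ∧ j + 1 = i := by
    unfold nbLeft; split_ifs <;> simp <;> grind
  have h2 : (ch j hj e' : LadderVertex l k) ∈ nbRight i hi e ↔ e' = e ∧ i + 1 = j := by
    unfold nbRight; split_ifs <;> simp <;> grind
  have h3 : (ch j hj e' : LadderVertex l k) ∈ nbInner i hi e ↔
      (e' = e ∧ ((i = l + 1 ∧ j = l + 3) ∨ (i = l + 3 ∧ j = l + 1))) ∨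
        (e' = !e) ∧ i = j ∧ i ≠ l + 1 ∧ i ≠ l + 3 := by
    unfold nbInner; split_ifs <;> simp <;> grind
  simp only [nb, List.mem_append, h1, h2, h3]
  simp only [and_or_left, or_assoc]

theorem q_mem_nb_ch (f : Bool) (i : ℕ) (hi : i < 2 * l + 6) (e a b : Bool) :
    (q a b : LadderVertex l k) ∈ nb f (ch i hi e) ↔ (i = 0 ∧ a = e) ∨ (i = 2 * l + 5 ∧ b = e) := by
  simp only [nb, nbLeft, nbRight, nbInner]
  cases a <;> cases b <;> split_ifs <;> simp <;> grind

theorem t_mem_nb_ch (f : Bool) (i : ℕ) (hi : i < 2 * l + 6) (e a : Bool) :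
    (t a : LadderVertex l k) ∈ nb f (ch i hi e) ↔
      (i = 0 ∧ a = false) ∨ (i = 2 * l + 5 ∧ a = true) := by
  simp only [nb, nbLeft, nbRight, nbInner]
  cases a <;> split_ifs <;> simp <;> grind

theorem w_notMem_nb_ch (f : Bool) (i : ℕ) (hi : i < 2 * l + 6) (e : Bool) :
    (w : LadderVertex l k) ∉ nb f (ch i hi e) := by
  simp only [nb, nbLeft, nbRight, nbInner]
  split_ifs <;> simp

theorem iso_notMem_nb_ch (f : Bool) (i : ℕ) (hi : i < 2 * l + 6) (e : Bool) (j : Fin k) :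
    (iso j : LadderVertex l k) ∉ nb f (ch i hi e) := by
  simp only [nb, nbLeft, nbRight, nbInner]
  split_ifs <;> simp

theorem nb_symm (f : Bool) (x y : LadderVertex l k) (h : y ∈ nb f x) : x ∈ nb f y := by
  rcases x with ⟨i, hi, e⟩ | ⟨a, b⟩ | a | _ | i <;> rcases y with ⟨j, hj, e'⟩ | ⟨a', b'⟩ | a' | _ | j
  case ch.ch =>
    rw [ch_mem_nb_ch] at h ⊢
    cases e <;> cases e' <;> simp at h ⊢ <;> omega
  case q.q =>
    simp only [nb, List.mem_cons, reduceCtorEq, q.injEq, List.not_mem_nil, false_or, or_false] at h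
    obtain ⟨rfl, rfl⟩ := h
    simp [nb]
  all_goals try
    simp only [q_mem_nb_ch, t_mem_nb_ch, w_notMem_nb_ch, iso_notMem_nb_ch] at h
  all_goals try
    simp only [q_mem_nb_ch, t_mem_nb_ch, w_notMem_nb_ch, iso_notMem_nb_ch]
  all_goals first
    | (simp [nb] at h ⊢; grind)
    | (cases a <;> simp [nb] at h ⊢ <;> grind)
    | (cases a' <;> simp [nb] at h ⊢ <;> grind)
    | (simp [nb] at h)

theorem nb_irrefl (f : Bool) (x : LadderVertex l k) : x ∉ nb f x := by
  rcases x with ⟨i, hi, e⟩ | ⟨a, b⟩ | a | _ | i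
  · simp only [nb, nbLeft, nbRight, nbInner, List.mem_append]
    split_ifs <;> simp <;> omega
  · simp [nb]
  · cases a <;> simp [nb]
  · simp [nb]
  · simp [nb]

theorem nb_nodup (f : Bool) (x : LadderVertex l k) : (nb f x).Nodup := by
  rcases x with ⟨i, hi, e⟩ | ⟨a, b⟩ | a | _ | i
  · simp only [nb, nbLeft, nbRight, nbInner]
    split_ifs <;> simp <;> omega
  · simp [nb]
  · cases a <;> simp [nb]
  · simp [nb]
  · simp [nb]

/-- The ladder graph with flag `f`. -/
def graph (l k : ℕ) (f : Bool) : SimpleGraph (LadderVertex l k) where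
  Adj x y := y ∈ nb f x
  symm := ⟨fun x y => nb_symm f x y⟩
  loopless := ⟨fun x => nb_irrefl f x⟩

theorem graph_adj (f : Bool) (x y : LadderVertex l k) : (graph l k f).Adj x y ↔ y ∈ nb f x := Iff.rfl

open Classical in
-- Neighbourhoods are duplicate-free lists, so colour counts become counts in a mapped list, and
-- equality of all counts becomes a permutation of lists.
theorem ncard_neighbours {C : Type*} (f : Bool) (κ : LadderVertex l k → C) (x : LadderVertex l k)
    (c : C) : {y | (graph l k f).Adj x y ∧ κ y = c}.ncard = ((nb f x).map κ).count c := by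
  have h : {y | (graph l k f).Adj x y ∧ κ y = c} = ((nb f x).filter (κ · = c)).toFinset := by
    ext y; simp [graph_adj]
  rw [h, Set.ncard_coe_finset, List.toFinset_card_of_nodup ((nb_nodup f x).filter _), List.count,
    List.countP_map, List.countP_eq_length_filter]
  congr 2

/-! ### Surviving the game on the ladder graphs -/

/-- The colour of a vertex: `g` on the path, `s` on the comparison gadget and the trigger. -/
def col (g : ℕ → Bool → ℕ) (s : Bool → ℕ) : LadderVertex l k → ℕ × ℕ
  | ch i _ e => (0, g i e)
  | q a _ => (1, s a)
  | t a => (2, s a)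
  | w => (3, 0)
  | iso _ => (4, 0)

/-- Vertices with the same colour under `κ'` have neighbours of the same colours under `κ`. -/
def Step {C C' : Type*} (κ : LadderVertex l k → C) (κ' : LadderVertex l k → C') : Prop :=
  ∀ f f' x y, κ' x = κ' y → κ x = κ y ∧ ((nb f x).map κ).Perm ((nb f' y).map κ)

/-- Both graphs have the same vertices, so the identity balances the colour classes, and
`exists_equiv_pointed` supplies the answer. The colouring `κ'` may be finer than one round of
refinement would make it; this only weakens the conclusion. -/
theorem Step.survives {C C' : Type*} {κ : LadderVertex l k → C} {κ' : LadderVertex l k → C'}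
    (h : Step κ κ') {f f' : Bool} {N : ℕ}
    (hN : Survives (graph l k f) (graph l k f') N fun x y => κ x = κ y) :
    Survives (graph l k f) (graph l k f') (N + 1) fun x y => κ' x = κ' y := by
  classical
  refine .succ N _ _ hN ⟨Equiv.refl _, fun _ => rfl⟩ fun x y hxy => ?_
  obtain ⟨h1, h2⟩ := h f f' x y hxy
  refine exists_equiv_pointed _ _ κ κ x y h1 (fun _ => rfl) fun c => ?_
  rw [ncard_neighbours, ncard_neighbours, h2.count_eq]

theorem map_nb_eq (g : ℕ → ℕ) (s : ℕ) (f f' : Bool) (i : ℕ) (hi : i < 2 * l + 6) (e e' : Bool) :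
    (nb f (ch i hi e : LadderVertex l k)).map (col (fun i _ => g i) fun _ => s) =
      (nb f' (ch i hi e' : LadderVertex l k)).map (col (fun i _ => g i) fun _ => s) := by
  simp only [nb, nbLeft, nbRight, nbInner]
  split_ifs <;> simp [col]

theorem map_nb_mirror (g : ℕ → ℕ) (s : ℕ) (f f' : Bool) (i j : ℕ) (hi : i < 2 * l + 6)
    (hj : j < 2 * l + 6) (e e' : Bool) (hij : i + j = 2 * l + 5) (h1 : i < l + 1 ∨ j < l + 1)
    (hg : g i = g j) (hg1 : i ≠ 0 → g (i - 1) = g (j + 1)) (hg2 : j ≠ 0 → g (i + 1) = g (j - 1)) :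
    ((nb f (ch i hi e : LadderVertex l k)).map (col (fun i _ => g i) fun _ => s)).Perm
      ((nb f' (ch j hj e' : LadderVertex l k)).map (col (fun i _ => g i) fun _ => s)) := by
  have hL : (nbLeft i hi e : List (LadderVertex l k)).map (col (fun i _ => g i) fun _ => s) =
      (nbRight j hj e' : List (LadderVertex l k)).map (col (fun i _ => g i) fun _ => s) := by
    unfold nbLeft nbRight
    by_cases h : i = 0
    · simp [h, show j = 2 * l + 5 by omega, col]
    · simp [h, show j ≠ 2 * l + 5 by omega, col, hg1 h]
  have hR : (nbRight i hi e : List (LadderVertex l k)).map (col (fun i _ => g i) fun _ => s) =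
      (nbLeft j hj e' : List (LadderVertex l k)).map (col (fun i _ => g i) fun _ => s) := by
    unfold nbLeft nbRight
    by_cases h : j = 0
    · simp [h, show i = 2 * l + 5 by omega, col]
    · simp [h, show i ≠ 2 * l + 5 by omega, col, hg2 h]
  have hI : (nbInner i hi e : List (LadderVertex l k)).map (col (fun i _ => g i) fun _ => s) =
      (nbInner j hj e' : List (LadderVertex l k)).map (col (fun i _ => g i) fun _ => s) := by
    unfold nbInner
    rw [if_neg (by omega), if_neg (by omega), if_neg (by omega), if_neg (by omega)]
    simp [col, hg]
  simp only [nb, List.map_append, hL, hR, hI]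
  rw [← List.append_assoc, ← List.append_assoc]
  exact List.perm_append_comm.append_right _

/-- A step between colourings that depend only on the pair, with mirror images not yet told apart
at the two ends. -/
theorem step_of_pair (g g' : ℕ → ℕ) (h0 : g 0 = g (2 * l + 5))
    (hg : ∀ i j, i < 2 * l + 6 → j < 2 * l + 6 → g' i = g' j → i ≤ j → g i = g j ∧
      (i = j ∨ (i < l + 1 ∧ i + j = 2 * l + 5 ∧ (i ≠ 0 → g (i - 1) = g (j + 1)) ∧
        g (i + 1) = g (j - 1)) ∨
      (i ≠ 0 ∧ j ≠ 2 * l + 5 ∧ ∃ c, ∀ m, (m + 1 = i ∨ m = i ∨ m = i + 1 ∨ m + 1 = j ∨ m = j ∨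
        m = j + 1 ∨ m = l + 1 ∨ m = l + 3) → g m = c))) :
    Step (col (fun i _ => g i) fun _ => 0 : LadderVertex l k → _)
      (col (fun i _ => g' i) fun _ => 0) := by
  have key : ∀ f f' i j hi hj e e', g' i = g' j → i ≤ j →
      g i = g j ∧ ((nb f (ch i hi e : LadderVertex l k)).map (col (fun i _ => g i) fun _ => 0)).Perm
      ((nb f' (ch j hj e' : LadderVertex l k)).map (col (fun i _ => g i) fun _ => 0)) := by
    intro f f' i j hi hj e e' h hle
    obtain ⟨h1, h2⟩ := hg i j hi hj h hle
    refine ⟨h1, ?_⟩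
    -- The cases are: the same pair; mirror images, whose left and right neighbours are exchanged;
    -- and two pairs away from the ends around which the colouring is constant. The last case
    -- includes the pairs `l + 1` and `l + 3`, since either can be an extra neighbour.
    rcases h2 with rfl | ⟨h2, h3, h4, h5⟩ | ⟨h2, h3, c, hc⟩
    · rw [map_nb_eq]
    · exact map_nb_mirror g 0 f f' i j hi hj e e' h3 (Or.inl h2) h1 h4 fun _ => h5
    · have hnb : ∀ f m hm e, (m = i ∨ m = j) →
          (nb f (ch m hm e : LadderVertex l k)).map (col (fun i _ => g i) fun _ => 0) =
            [(0, c), (0, c), (0, c)] := by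
        intro f m hm e hmij
        have e1 : g (m - 1) = c := hc _ (by omega)
        have e2 : g m = c := hc _ (by omega)
        have e3 : g (m + 1) = c := hc _ (by omega)
        have e4 : g (l + 1) = c := hc _ (by omega)
        have e5 : g (l + 3) = c := hc _ (by omega)
        simp only [nb, nbLeft, nbRight, nbInner]
        rw [if_neg (by omega), dif_neg (by omega)]
        split_ifs with h h
        · subst h; simp at e1 e3; simp [col, e1, e3, e5]
        · subst h; simp at e1 e3; simp [col, e1, e3, e4]
        · simp [col, e1, e2, e3]
      rw [hnb f i hi e (Or.inl rfl), hnb f' j hj e' (Or.inr rfl)]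
  intro f f' x y hxy
  rcases x with ⟨i, hi, e⟩ | ⟨a, b⟩ | a | _ | i <;>
    rcases y with ⟨j, hj, e'⟩ | ⟨a', b'⟩ | a' | _ | j <;> try (simp [col] at hxy; done)
  · simp only [col, Prod.mk.injEq, true_and] at hxy ⊢
    rcases le_total i j with h | h
    · exact key f f' i j hi hj e e' hxy h
    · exact (key f' f j i hj hi e' e hxy.symm h).imp Eq.symm fun h => h.symm
  · simp [col, nb, h0]
  · cases a <;> cases a' <;> simp [col, nb, h0]
  · simp [col, nb]
  · simp [col, nb]

/-- The distance from a pair to the nearer end of the path. -/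
def rank (l i : ℕ) : ℕ := min i (2 * l + 5 - i)

/-- The colouring in which the pairs of rank less than `s` are found, up to reflection. -/
def colA (l k s : ℕ) : LadderVertex l k → ℕ × ℕ := col (fun i _ => min (rank l i) s) fun _ => 0

/-- The colouring in which the pairs of rank at least `b` are told apart from their mirror
images. -/
def colB (l k b : ℕ) : LadderVertex l k → ℕ × ℕ :=
  col (fun i _ => if 2 * l + 5 < b + i then 2 * l + 5 - i else i) fun _ => 0

/-- The colouring in which the two vertices of each of the first `c` pairs are told apart. -/
def colC (l k c : ℕ) : LadderVertex l k → ℕ × ℕ :=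
  col (fun i e => if i < c then 2 * i + e.toNat else 2 * i) Bool.toNat

/-- A pair of rank at least `s + 1` sees only ranks at least `s`, which `colA l k s` merges. A
smaller rank leaves just the pair and its mirror image. -/
theorem step_colA (s : ℕ) (hs : s ≤ l) : Step (colA l k s) (colA l k (s + 1)) := by
  refine step_of_pair _ _ (by simp [rank]) fun i j hi hj h hle => ?_
  simp only [rank] at *
  refine ⟨by omega, ?_⟩
  by_cases h1 : i = j
  · exact Or.inl h1
  by_cases h2 : i < s + 1
  · right; left; omega
  · right; right; exact ⟨by omega, by omega, s, fun m hm => by omega⟩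

/-- The pairs `l + 1`, ..., `l + 4` around the crossing all become distinct at once. Pairs still
sharing a colour are mirror images outside this zone, where the path is symmetric. -/
theorem step_colA_colB : Step (colA l k (l + 1)) (colB l k (l + 1)) := by
  refine step_of_pair _ _ (by simp [rank]) fun i j hi hj h hle => ?_
  simp only [rank] at *
  have : i = j ∨ i < l + 1 ∧ i + j = 2 * l + 5 := by split_ifs at h <;> omega
  clear h
  omega

/-- Mirror images of rank below `b` have neighbours of rank at most `b`, which `colB l k (b + 1)`
still merges with their mirror images. -/
theorem step_colB (b : ℕ) (hb : b ≤ l) : Step (colB l k (b + 1)) (colB l k b) := by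
  refine step_of_pair _ _ (by simp; omega) fun i j hi hj h hle => ?_
  have : i = j ∨ i < b ∧ i + j = 2 * l + 5 := by split_ifs at h <;> omega
  clear h
  rcases this with rfl | ⟨h1, h2⟩
  · simp
  refine ⟨by split_ifs <;> omega, .inr (.inl ⟨by omega, h2, fun h3 => ?_, ?_⟩)⟩ <;>
  · split_ifs <;> omega

theorem colC_eq_iff (c i j : ℕ) (e e' : Bool) : ((if i < c then 2 * i + e.toNat else 2 * i) =
    if j < c then 2 * j + e'.toNat else 2 * j) ↔ i = j ∧ (i < c → e = e') := by
  cases e <;> cases e' <;> simp <;> split_ifs <;> omega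

/-- Under `colB l k 0` all pairs are distinct, but a colour never depends on `e`, so the two
vertices of a pair look alike. The new colouring separates the triggers, the two halves of the
gadget and the first pair in a single step, which concedes more than refinement would. -/
theorem step_colB_colC : Step (colB l k 0) (colC l k 1) := by
  intro f f' x y hxy
  rcases x with ⟨i, hi, e⟩ | ⟨a, b⟩ | a | _ | i <;>
    rcases y with ⟨j, hj, e'⟩ | ⟨a', b'⟩ | a' | _ | j <;> try (simp [colC, col] at hxy; done)
  · simp only [colC, col, Prod.mk.injEq, true_and, colC_eq_iff] at hxy
    obtain ⟨rfl, -⟩ := hxy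
    exact ⟨rfl, by unfold colB; rw [map_nb_eq]⟩
  · simp [colB, col, nb]
  · have : a = a' := by cases a <;> cases a' <;> simp [colC, col] at hxy ⊢
    subst this
    cases a <;> simp [colB, col, nb]
  · simp [nb, colB, col]
  · simp [nb, colB, col]

/-- A pair from `c'` on sees no split pair, provided the crossing does not let it look back from `l
+ 3` to a split pair `l + 1`. The last hypothesis excludes this: either `l + 1` is not yet split or
`l + 3` is split now. -/
theorem step_colC (c c' : ℕ) (hc : c < c') (hc' : c' ≤ 2 * l + 5)
    (h : c ≤ l + 1 ∨ l + 3 < c') : Step (colC l k c) (colC l k c') := by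
  intro f f' x y hxy
  rcases x with ⟨i, hi, e⟩ | ⟨a, b⟩ | a | _ | i <;>
    rcases y with ⟨j, hj, e'⟩ | ⟨a', b'⟩ | a' | _ | j <;> try (simp [colC, col] at hxy; done)
  · simp only [colC, col, Prod.mk.injEq, true_and, colC_eq_iff] at hxy ⊢
    obtain ⟨rfl, he⟩ := hxy
    refine ⟨⟨rfl, fun h => he (by omega)⟩, ?_⟩
    by_cases hi' : i < c'
    · obtain rfl := he hi'
      exact List.Perm.refl _
    · refine List.Perm.of_eq ?_
      simp only [nb, nbLeft, nbRight, nbInner]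
      have n1 : ¬ i - 1 < c := by omega
      have n2 : ¬ i + 1 < c := by omega
      have n3 : ¬ i < c := by omega
      have n4 : i = l + 1 → ¬ l + 3 < c := by omega
      have n5 : i = l + 3 → ¬ l + 1 < c := by omega
      simp only [if_neg (show i ≠ 0 by omega)]
      split_ifs <;> first
        | (simp [col, n1, n2, n3]; done)
        | (simp [col, n1, n2, n4 (by assumption)])
        | (simp [col, n1, n2, n5 (by assumption)])
  · have : a = a' := by cases a <;> cases a' <;> simp [colC, col] at hxy ⊢
    subst this
    simp [colC, col, nb, show ¬ 2 * l + 5 < c by omega]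
  · have : a = a' := by cases a <;> cases a' <;> simp [colC, col] at hxy ⊢
    subst this
    exact ⟨rfl, by cases a <;> exact List.Perm.refl _⟩
  · simp [nb]
  · simp [nb, colC, col]

/-- The colourings of the ladder graphs are a strategy for `4 * l + 8` rounds. -/
theorem survives (l k : ℕ) :
    ∃ R, Survives (graph l k true) (graph l k false) (4 * l + 8) R := by
  set S := fun N (κ : LadderVertex l k → ℕ × ℕ) =>
    Survives (graph l k true) (graph l k false) N fun x y => κ x = κ y
  -- The count runs backwards in time: the coarsest colouring needs no rounds, and each finer one
  -- allows a further round.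
  have hA : ∀ s ≤ l + 1, S s (colA l k s) := by
    intro s
    induction s with
    | zero => exact fun _ => .zero _
    | succ s ih => exact fun hs => (step_colA s (by omega)).survives (ih (by omega))
  have hB : ∀ s b, s + b = l + 1 → S (l + 2 + s) (colB l k b) := by
    intro s
    induction s with
    | zero =>
      intro b hb
      obtain rfl : b = l + 1 := by omega
      exact step_colA_colB.survives (hA (l + 1) le_rfl)
    | succ s ih =>
      intro b hb
      exact (step_colB b (by omega)).survives (ih (b + 1) (by omega))
  have hC : ∀ c ≤ l + 1, S (2 * l + 4 + c) (colC l k (c + 1)) := by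
    intro c
    induction c with
    | zero =>
      intro _
      have := step_colB_colC.survives (hB (l + 1) 0 (by omega))
      rwa [show l + 2 + (l + 1) + 1 = 2 * l + 4 + 0 by omega] at this
    | succ c ih =>
      exact fun hc => (step_colC (c + 1) (c + 2) (by omega) (by omega) (by omega)).survives
        (ih (by omega))
  have hC' : ∀ c ≤ l + 1, S (3 * l + 6 + c) (colC l k (l + 4 + c)) := by
    intro c
    induction c with
    | zero =>
      intro _
      -- The pair `l + 1` is joined to both `l + 2` and `l + 3`, so these two split in the same
      -- round.
      have := (step_colC (l + 2) (l + 4) (by omega) (by omega) (by omega)).survives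
        (hC (l + 1) le_rfl)
      rwa [show 2 * l + 4 + (l + 1) + 1 = 3 * l + 6 + 0 by omega] at this
    | succ c ih =>
      exact fun hc => (step_colC (l + 4 + c) (l + 4 + (c + 1)) (by omega) (by omega)
        (by omega)).survives (ih (by omega))
  have := hC' (l + 1) le_rfl
  rw [show 3 * l + 6 + (l + 1) = 4 * l + 7 by omega] at this
  -- One more round is gained from the empty board: only `start` matters there, and the empty
  -- relation makes `forth` vacuous.
  exact ⟨fun _ _ => False, .succ _ _ _ this ⟨Equiv.refl _, fun _ => rfl⟩ fun _ _ => False.elim⟩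

end LadderVertex
-- A sentence that distinguishes the ladder graphs
namespace LadderVertex

variable {l k : ℕ}

/-- Sets of vertices defined by one and the same formula in both ladder graphs. -/
def IsDefinable (p : LadderVertex l k → Prop) : Prop :=
  ∃ d, Definable (graph l k true) (graph l k false) d p p

theorem IsDefinable.and_not {p p' r : LadderVertex l k → Prop} (h : IsDefinable p)
    (h' : IsDefinable p') (hr : ∀ x, r x ↔ p x ∧ ¬ p' x) : IsDefinable r := by
  obtain ⟨d, h⟩ := h
  obtain ⟨d', h'⟩ := h'
  obtain rfl : r = fun x => p x ∧ ¬ p' x := funext fun x => propext (hr x)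
  exact ⟨max d d', (h.mono (le_max_left _ _)).and (h'.mono (le_max_right _ _)).not⟩

/-- The description of `r` has to hold for both flags, so that one formula defines the same vertex
set in both graphs. -/
theorem IsDefinable.and_exists {p p' r : LadderVertex l k → Prop} (h : IsDefinable p)
    (h' : IsDefinable p') (hr : ∀ f x, r x ↔ p x ∧ ∃ y ∈ nb f x, p' y) : IsDefinable r := by
  obtain ⟨d, h⟩ := h
  obtain ⟨d', h'⟩ := h'
  refine ⟨max d (d' + 1), ?_⟩
  convert (h.mono (le_max_left d (d' + 1))).and
    (h'.exists_neighbour.mono (le_max_right d (d' + 1))) using 1 <;>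
  exact funext fun x => propext (hr _ x)

/-- A set of vertices given by its parts. -/
def parts (S : ℕ → Bool → Prop) (Q : Bool → Bool → Prop) (T : Bool → Prop) (W I : Prop) :
    LadderVertex l k → Prop
  | ch i _ e => S i e
  | q a b => Q a b
  | t a => T a
  | w => W
  | iso _ => I

theorem isDefinable_univ : IsDefinable (parts (l := l) (k := k) (fun _ _ => True)
    (fun _ _ => True) (fun _ => True) True True) :=
  ⟨0, by convert Definable.true 0 using 1 <;> exact funext fun x => by cases x <;> rfl⟩

/-- The threshold 4 works because inner path vertices have degree 3, `w` has degree 2 and isolated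
vertices 0, whereas `q` has degree 4 and the end pairs and triggers have degree 5. -/
theorem isDefinable_degree : IsDefinable (parts (l := l) (k := k)
    (fun i _ => i = 0 ∨ i = 2 * l + 5) (fun _ _ => True) (fun _ => True) False False) := by
  classical
  have key : ∀ (f : Bool) (x : LadderVertex l k), parts (fun i _ => i = 0 ∨ i = 2 * l + 5)
      (fun _ _ => True) (fun _ => True) False False x ↔
        ((4 : ℕ) : ℕ∞) ≤ {y | (graph l k f).Adj x y ∧ True}.encard := by
    intro f x
    have h := ncard_neighbours f (fun _ => ()) x ()
    simp only [List.map_const', List.count_replicate_self] at h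
    rw [le_encard_iff_le_ncard, h]
    rcases x with ⟨i, hi, e⟩ | ⟨a, b⟩ | a | _ | i
    · simp only [nb, nbLeft, nbRight, nbInner, parts]
      split_ifs <;> simp <;> omega
    · simp [nb, parts]
    · cases a <;> simp [nb, parts]
    · simp [nb, parts]
    · simp [nb, parts]
  refine ⟨0 + 1, ?_⟩
  convert (Definable.true (G := graph l k true) (H := graph l k false) 0).le_neighbours 4 using 1 <;>
  exact funext fun x => propext (key _ x)

theorem isDefinable_inner : IsDefinable (parts (l := l) (k := k)
    (fun i _ => i ≠ 0 ∧ i ≠ 2 * l + 5) (fun _ _ => False) (fun _ => False) True True) :=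
  isDefinable_univ.and_not isDefinable_degree fun x => by cases x <;> simp [parts]

/-- This is the purpose of `w`: it gives the triggers a neighbour of small degree, which the gadget
vertices lack. -/
theorem isDefinable_end_or_t : IsDefinable (parts (l := l) (k := k)
    (fun i _ => i = 0 ∨ i = 2 * l + 5) (fun _ _ => False) (fun _ => True) False False) := by
  refine isDefinable_degree.and_exists isDefinable_inner fun f x => ?_
  rcases x with ⟨i, hi, e⟩ | ⟨a, b⟩ | a | _ | i
  · simp only [nb, nbLeft, nbRight, nbInner]
    split_ifs <;> simp [parts] <;> omega
  · simp [nb, parts]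
  · cases a <;> simp [nb, parts]
  · simp [nb, parts]
  · simp [nb, parts]

theorem isDefinable_q : IsDefinable (parts (l := l) (k := k)
    (fun _ _ => False) (fun _ _ => True) (fun _ => False) False False) :=
  isDefinable_degree.and_not isDefinable_end_or_t fun x => by cases x <;> simp [parts]; omega

theorem isDefinable_inner_path : IsDefinable (parts (l := l) (k := k)
    (fun i _ => i ≠ 0 ∧ i ≠ 2 * l + 5) (fun _ _ => False) (fun _ => False) False False) := by
  refine isDefinable_inner.and_exists isDefinable_inner fun f x => ?_
  rcases x with ⟨i, hi, e⟩ | ⟨a, b⟩ | a | _ | i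
  · simp only [nb, nbLeft, nbRight, nbInner]
    split_ifs <;> simp [parts] <;> omega
  · simp [nb, parts]
  · cases a <;> simp [nb, parts]
  · simp [nb, parts]
  · simp [nb, parts]

theorem isDefinable_end : IsDefinable (parts (l := l) (k := k)
    (fun i _ => i = 0 ∨ i = 2 * l + 5) (fun _ _ => False) (fun _ => False) False False) := by
  refine isDefinable_degree.and_exists isDefinable_inner_path fun f x => ?_
  rcases x with ⟨i, hi, e⟩ | ⟨a, b⟩ | a | _ | i
  · simp only [nb, nbLeft, nbRight, nbInner]
    split_ifs <;> simp [parts] <;> omega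
  · simp [nb, parts]
  · cases a <;> simp [nb, parts]
  · simp [nb, parts]
  · simp [nb, parts]

theorem isDefinable_t : IsDefinable (parts (l := l) (k := k)
    (fun _ _ => False) (fun _ _ => False) (fun _ => True) False False) :=
  isDefinable_end_or_t.and_not isDefinable_end fun x => by cases x <;> simp [parts]; omega

/-- The vertices of the path in pairs with a given property. -/
def onPath (S : ℕ → Bool → Prop) : LadderVertex l k → Prop :=
  parts S (fun _ _ => False) (fun _ => False) False False

theorem isDefinable_path : IsDefinable (onPath (l := l) (k := k) fun _ _ => True) := by
  have h : IsDefinable (parts (l := l) (k := k) (fun i _ => i = 0 ∨ i = 2 * l + 5)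
      (fun _ _ => True) (fun _ => True) True True) :=
    isDefinable_univ.and_not isDefinable_inner_path fun x => by cases x <;> simp [parts]; omega
  have h' : IsDefinable (parts (l := l) (k := k) (fun i _ => False)
      (fun _ _ => True) (fun _ => True) True True) :=
    h.and_not isDefinable_end fun x => by cases x <;> simp [parts]; omega
  exact isDefinable_univ.and_not h' fun x => by cases x <;> simp [parts, onPath]

theorem IsDefinable.onPath_and_not {S S' R : ℕ → Bool → Prop}
    (h : IsDefinable (onPath (l := l) (k := k) S)) (h' : IsDefinable (onPath (l := l) (k := k) S'))
    (hR : ∀ i e, i < 2 * l + 6 → (R i e ↔ S i e ∧ ¬ S' i e)) :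
    IsDefinable (onPath (l := l) (k := k) R) := by
  refine h.and_not h' fun x => ?_
  rcases x with ⟨i, hi, e⟩ | ⟨a, b⟩ | a | _ | i <;> simp [onPath, parts]
  exact hR i e hi

theorem IsDefinable.onPath_and_exists {S S' R : ℕ → Bool → Prop}
    (h : IsDefinable (onPath (l := l) (k := k) S)) (h' : IsDefinable (onPath (l := l) (k := k) S'))
    (hR : ∀ i e, i < 2 * l + 6 → (R i e ↔ S i e ∧ ((i ≠ 0 ∧ S' (i - 1) e) ∨
      (i ≠ 2 * l + 5 ∧ S' (i + 1) e) ∨ (i = l + 1 ∧ S' (l + 3) e) ∨ (i = l + 3 ∧ S' (l + 1) e) ∨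
      (i ≠ l + 1 ∧ i ≠ l + 3 ∧ S' i !e)))) :
    IsDefinable (onPath (l := l) (k := k) R) := by
  refine h.and_exists h' fun f x => ?_
  rcases x with ⟨i, hi, e⟩ | ⟨a, b⟩ | a | _ | i
  · have h1 : (∃ y ∈ (nbLeft i hi e : List (LadderVertex l k)), onPath S' y) ↔
        i ≠ 0 ∧ S' (i - 1) e := by
      by_cases h : i = 0 <;> simp [nbLeft, h, onPath, parts]
    have h2 : (∃ y ∈ (nbRight i hi e : List (LadderVertex l k)), onPath S' y) ↔
        i ≠ 2 * l + 5 ∧ S' (i + 1) e := by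
      by_cases h : i = 2 * l + 5 <;> simp [nbRight, h, onPath, parts]
    have h3 : (∃ y ∈ (nbInner i hi e : List (LadderVertex l k)), onPath S' y) ↔
        (i = l + 1 ∧ S' (l + 3) e) ∨ (i = l + 3 ∧ S' (l + 1) e) ∨
          (i ≠ l + 1 ∧ i ≠ l + 3 ∧ S' i !e) := by
      by_cases h : i = l + 1
      · subst h; simp [nbInner, onPath, parts]
      by_cases h' : i = l + 3
      · subst h'; simp [nbInner, onPath, parts]
      simp [nbInner, h, h', onPath, parts]
    refine (hR i e hi).trans ?_
    simp only [nb, List.mem_append, or_and_right, exists_or, h1, h2, h3]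
    rfl
  all_goals simp [onPath, parts]

theorem isDefinable_le_rank (r : ℕ) :
    IsDefinable (onPath (l := l) (k := k) fun i _ => i ≤ r ∨ 2 * l + 5 ≤ i + r) := by
  induction r with
  | zero =>
    convert isDefinable_end (l := l) (k := k) using 1
    funext x
    rcases x with ⟨i, hi, e⟩ | ⟨a, b⟩ | a | _ | i <;> simp [onPath, parts]
    omega
  | succ r ih =>
    exact isDefinable_path.onPath_and_exists ih fun i e hi => by simp only [true_and]; omega

theorem isDefinable_rank (r : ℕ) (hr : r ≤ l + 2) :
    IsDefinable (onPath (l := l) (k := k) fun i _ => i = r ∨ i + r = 2 * l + 5) := by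
  rcases r with _ | r
  · exact (isDefinable_le_rank 0).onPath_and_exists isDefinable_path fun i e hi => by
      simp only [and_true]; omega
  · exact (isDefinable_le_rank (r + 1)).onPath_and_not (isDefinable_le_rank r)
      fun i e hi => by omega

/-- The mirror symmetry breaks here: of the two pairs of rank `l + 1`, only `l + 4` is an edge,
while `l + 1` is joined to `l + 3`, of rank `l + 2`. From `l + 4` the distinction spreads outwards.
-/
theorem isDefinable_pair_right (r : ℕ) (hr : r ≤ l + 1) :
    IsDefinable (onPath (l := l) (k := k) fun i _ => i = l + 4 + r) := by
  induction r with
  | zero =>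
    exact (isDefinable_rank (l + 1) (by omega)).onPath_and_exists
      (isDefinable_rank (l + 1) (by omega)) fun i e hi => by omega
  | succ r ih =>
    exact (isDefinable_rank (l - r) (by omega)).onPath_and_exists (ih (by omega))
      fun i e hi => by omega

theorem isDefinable_pair (j : ℕ) (hj : j < 2 * l + 6) :
    IsDefinable (onPath (l := l) (k := k) fun i _ => i = j) := by
  have h3 : IsDefinable (onPath (l := l) (k := k) fun i _ => i = l + 3) :=
    (isDefinable_rank (l + 2) le_rfl).onPath_and_exists (isDefinable_pair_right 0 (by omega))
      fun i e hi => by omega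
  rcases lt_trichotomy j (l + 3) with h | rfl | h
  · rcases Nat.lt_or_ge j (l + 2) with h' | h'
    · exact (isDefinable_rank j (by omega)).onPath_and_not
        (isDefinable_pair_right (l + 1 - j) (by omega)) fun i e hi => by omega
    · exact (isDefinable_rank j (by omega)).onPath_and_not h3 fun i e hi => by omega
  · exact h3
  · obtain ⟨r, rfl⟩ := Nat.exists_eq_add_of_lt h
    convert isDefinable_pair_right (l := l) (k := k) r (by omega) using 4
    omega

theorem isDefinable_t_false : IsDefinable (parts (l := l) (k := k)
    (fun _ _ => False) (fun _ _ => False) (fun a => a = false) False False) := by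
  refine isDefinable_t.and_exists (isDefinable_pair 0 (by omega)) fun f x => ?_
  rcases x with ⟨i, hi, e⟩ | ⟨a, b⟩ | a | _ | i
  case t => cases a <;> simp [nb, onPath, parts]
  all_goals simp [parts]

theorem isDefinable_q_left : IsDefinable (parts (l := l) (k := k)
    (fun _ _ => False) (fun a _ => a = false) (fun _ => False) False False) := by
  refine isDefinable_q.and_exists isDefinable_t_false fun f x => ?_
  rcases x with ⟨i, hi, e⟩ | ⟨a, b⟩ | a | _ | i
  case q => cases a <;> simp [nb, parts]
  all_goals simp [parts]

/-- The half of the gadget at the left trigger selects one vertex of the first pair. Edges between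
consecutive pairs keep `e`, so the selection passes along the path. -/
theorem isDefinable_ch_false (j : ℕ) (hj : j < 2 * l + 6) :
    IsDefinable (onPath (l := l) (k := k) fun i e => i = j ∧ e = false) := by
  induction j with
  | zero =>
    refine (isDefinable_pair 0 hj).and_exists isDefinable_q_left fun f x => ?_
    rcases x with ⟨i, hi, e⟩ | ⟨a, b⟩ | a | _ | i
    · simp only [nb, nbLeft, nbRight, nbInner]
      split_ifs <;> simp [onPath, parts] <;> omega
    all_goals simp [onPath, parts]
  | succ j ih =>
    refine (isDefinable_pair (j + 1) hj).onPath_and_exists (ih (by omega)) fun i e hi => ?_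
    constructor
    · rintro ⟨rfl, rfl⟩
      simp
    · rintro ⟨rfl, h⟩
      refine ⟨rfl, ?_⟩
      rcases h with h | h | h | h | h <;> first | exact h.2.2 | omega

theorem isDefinable_q_right : IsDefinable (parts (l := l) (k := k)
    (fun _ _ => False) (fun _ b => b = false) (fun _ => False) False False) := by
  refine isDefinable_q.and_exists (isDefinable_ch_false (2 * l + 5) (by omega)) fun f x => ?_
  rcases x with ⟨i, hi, e⟩ | ⟨a, b⟩ | a | _ | i
  case q => simp [nb, onPath, parts]
  all_goals simp [parts]

theorem exists_distinguishes (l k : ℕ) :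
    ∃ φ : FO2C, φ.Distinguishes (graph l k true) (graph l k false) := by
  obtain ⟨d, h⟩ := isDefinable_q_right (l := l) (k := k)
  -- The set consists of the `q _ false` with a neighbour of the same kind. The matching flips `b`
  -- for the flag `true` and keeps it for `false`, so the set is empty in the first graph only.
  have h' := (h.mono (Nat.le_succ d)).and h.exists_neighbour
  obtain ⟨φ, hφ, -⟩ := h'.exists_distinguishes (by
    rw [show {x : LadderVertex l k | parts (fun _ _ => False) (fun _ b => b = false)
        (fun _ => False) False False x ∧ ∃ y, (graph l k true).Adj x y ∧
        parts (fun _ _ => False) (fun _ b => b = false) (fun _ => False) False False y} = ∅ from ?_]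
    · intro h0
      rw [Set.encard_empty, eq_comm, Set.encard_eq_zero, Set.eq_empty_iff_forall_notMem] at h0
      exact h0 (q false false) ⟨rfl, q true false, by simp [graph_adj, nb], rfl⟩
    · rw [Set.eq_empty_iff_forall_notMem]
      rintro x ⟨h1, y, h2, h3⟩
      rcases x with ⟨i, hi, e⟩ | ⟨a, b⟩ | a | _ | i
      case q =>
        rw [graph_adj] at h2
        rcases y with ⟨j, hj, e'⟩ | ⟨a', b'⟩ | a' | _ | j
        case q =>
          simp only [parts] at h1 h3
          subst h1; subst h3
          simp [nb] at h2
        all_goals exact h3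
      all_goals exact h1)
  exact ⟨φ, hφ⟩

end LadderVertex

/-! ### Numerical bounds and the main theorem -/

theorem FO2C.depth_pos_of_isSentence (φ : FO2C) (h : φ.IsSentence) : 0 < φ.depth := by
  induction φ with
  | eq i j => simp [IsSentence, freeVars] at h
  | adj i j => simp [IsSentence, freeVars] at h
  | neg φ ih => exact ih h
  | conj φ ψ ih _ =>
    exact lt_of_lt_of_le (ih (Finset.union_eq_empty.1 h).1) (le_max_left _ _)
  | exGE m i φ _ => exact Nat.succ_pos _

theorem lt_fo2cDepth {V W : Type*} {G : SimpleGraph V} {H : SimpleGraph W} {d : ℕ}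
    (h : FO2CDistinguishable G H) (hd : ∀ φ : FO2C, φ.Distinguishes G H → d < φ.depth) :
    d < FO2CDepth G H := by
  obtain ⟨φ, hφ⟩ := h
  have hne : {d : ℕ | ∃ φ : FO2C, φ.Distinguishes G H ∧ φ.depth = d}.Nonempty := ⟨_, φ, hφ, rfl⟩
  obtain ⟨ψ, h1, h2⟩ := Nat.sInf_mem hne
  exact lt_of_lt_of_eq (hd ψ h1) h2

theorem FO2C.distinguishes_congr {V W V' W' : Type*} {G : SimpleGraph V} {H : SimpleGraph W}
    {G' : SimpleGraph V'} {H' : SimpleGraph W'} (e : G ≃g G') (e' : H ≃g H') (φ : FO2C) :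
    φ.Distinguishes G H ↔ φ.Distinguishes G' H' := by
  unfold Distinguishes
  rw [holds_iff_of_iso e, holds_iff_of_iso e']

theorem exists_fo2cDepth_gt_sub (n : ℕ) (hn : 19 ≤ n) : ∃ G H : SimpleGraph (Fin n),
    FO2CDistinguishable G H ∧ n < FO2CDepth G H + 14 := by
  -- Raising `l` by one adds four vertices, so at most three isolated ones fill the gap. Hence `n ≤
  -- 4 * l + 22`, and depth at least `4 * l + 9` gives the constant 14.
  obtain ⟨l, k, hk, rfl⟩ : ∃ l k, k < 4 ∧ n = 4 * l + 19 + k :=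
    ⟨(n - 19) / 4, (n - 19) % 4, Nat.mod_lt _ (by norm_num), by omega⟩
  let e : LadderVertex l k ≃ Fin (4 * l + 19 + k) :=
    Finite.equivFinOfCardEq (LadderVertex.natCard l k)
  let E := fun f => SimpleGraph.Iso.map e (LadderVertex.graph l k f)
  have hdist : FO2CDistinguishable ((LadderVertex.graph l k true).map e.toEmbedding)
      ((LadderVertex.graph l k false).map e.toEmbedding) :=
    (LadderVertex.exists_distinguishes l k).imp fun φ =>
      (distinguishes_congr (E true) (E false) φ).1
  refine ⟨_, _, hdist, ?_⟩
  have : 4 * l + 8 < FO2CDepth ((LadderVertex.graph l k true).map e.toEmbedding)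
      ((LadderVertex.graph l k false).map e.toEmbedding) := by
    refine lt_fo2cDepth hdist fun φ hφ => ?_
    by_contra! hle
    obtain ⟨R, hR⟩ := LadderVertex.survives l k
    exact (xor_iff_not_iff _ _).1 ((distinguishes_congr (E true) (E false) φ).2 hφ).2
      (holds_iff_of_survives hR hle)
  omega

theorem fo2cDistinguishable_bot_top (n : ℕ) (hn : 2 ≤ n) :
    FO2CDistinguishable (⊥ : SimpleGraph (Fin n)) (⊤ : SimpleGraph (Fin n)) := by
  have h := (Definable.true (G := (⊥ : SimpleGraph (Fin n))) (H := (⊤ : SimpleGraph (Fin n)))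
    0).exists_neighbour
  obtain ⟨φ, hφ, -⟩ := h.exists_distinguishes (by
    intro h0
    simp only [SimpleGraph.bot_adj, exists_false, and_true] at h0
    rw [eq_comm] at h0
    simp only [Set.ofPred_false, Set.encard_empty, Set.encard_eq_zero] at h0
    rw [Set.eq_empty_iff_forall_notMem] at h0
    exact h0 ⟨0, by omega⟩ ⟨⟨1, by omega⟩, by simp⟩)
  exact ⟨φ, hφ⟩

theorem mainTheorem2 :
    (∀ (n : ℕ) (V : Type*) (W : Type*) [Fintype V] [Fintype W]
      (G : SimpleGraph V) (H : SimpleGraph W),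
      Fintype.card V = n → Fintype.card W = n →
      FO2CDistinguishable G H → FO2CDepth G H ≤ n + 1) ∧
    (∀ n : ℕ, 2 ≤ n → ∃ G H : SimpleGraph (Fin n),
      FO2CDistinguishable G H ∧ (n : ℝ) - 8 * Real.sqrt (n : ℝ) < (FO2CDepth G H : ℝ)) := by
  refine ⟨fun n V W _ _ G H hV _ h => ?_, fun n hn => ?_⟩
  · have := fo2cDepth_le_card_add_one G H h
    rwa [Nat.card_eq_fintype_card, hV] at this
  · rcases Nat.lt_or_ge n 19 with h | h
    · have hd := fo2cDistinguishable_bot_top n hn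
      refine ⟨⊥, ⊤, hd, ?_⟩
      have h1 : 0 < FO2CDepth (⊥ : SimpleGraph (Fin n)) (⊤ : SimpleGraph (Fin n)) :=
        lt_fo2cDepth hd fun φ hφ => depth_pos_of_isSentence φ hφ.1
      have h2 : (0 : ℝ) < FO2CDepth (⊥ : SimpleGraph (Fin n)) (⊤ : SimpleGraph (Fin n)) := by
        exact_mod_cast h1
      -- For such small `n` the number `n - 8 √n` is not positive, while every sentence has positive
      -- depth.
      have h3 : (n : ℝ) / 8 ≤ Real.sqrt n := by
        refine Real.le_sqrt_of_sq_le ?_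
        have : (n : ℝ) < 19 := by exact_mod_cast h
        nlinarith [(Nat.cast_nonneg n : (0 : ℝ) ≤ n)]
      linarith
    · obtain ⟨G, H, hd, hlt⟩ := exists_fo2cDepth_gt_sub n h
      refine ⟨G, H, hd, ?_⟩
      have h1 : (n : ℝ) < FO2CDepth G H + 14 := by exact_mod_cast hlt
      -- This crude bound is enough, since `8 * 2 > 14`.
      have h2 : (2 : ℝ) ≤ Real.sqrt n := by
        refine Real.le_sqrt_of_sq_le ?_
        have : (19 : ℝ) ≤ n := by exact_mod_cast h
        linarith
      linarith
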